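/- Let $d\ge 1$, and equip $\mathbb{R}^d$ with the Euclidean norm $\|\cdot\|$. Let $\mathrm{Lip}_1([0,1]^d)$ be the space of all $1$-Lipschitz functions $f:[0,1]^d\to\mathbb{R}$ (i.e. $|f(x)-f(y)|\le\|x-y\|$ for all $x,y$), with the metric $\rho(f,g)=\|f-g\|_\infty$. A subset of a topological space is called residual if its complement is meagre (a countable union of nowhere dense sets); it is relatively residual in a set $F$ if it is a residual subset of $F$ with the subspace topology. Let $\emptyset\neq F\subseteq[0,1]$ be a closed set with every portion of positive measure, i.e. for every open $U\subseteq\mathbb{R}$ with $U\cap F\neq\emptyset$ the set $U\cap F$ has positive Lebesgue measure. Let $E\subseteq F$ be relatively residual in $F$. Let $\gamma:[0,1]\to(0,1)^d$ be $1$-Lipschitz and such that, for some $c>0$, $\|\gamma'(t)\|\ge c$ for almost every $t\in[0,1]$. Suppose that $\gamma$ is differentiable with $\|\gamma'(t)\|=1$ at every $t\in E$ (with one-sided derivatives at the endpoints of $[0,1]$). Then the set of those $f\in\mathrm{Lip}_1([0,1]^d)$ for which there exists $t\in E$ such that $f$ is differentiable at $\gamma(t)$ with $\|\nabla f(\gamma(t))\|=1$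 is residual in $\mathrm{Lip}_1([0,1]^d)$. -/

import Mathlib

open Set MeasureTheory Topology

namespace TypicalLip

/-- The closed unit cube `[0,1]^d` in Euclidean space. -/
def cube (d : ℕ) : Set (EuclideanSpace ℝ (Fin d)) :=
  {x | ∀ i, x i ∈ Icc (0 : ℝ) 1}

/-- The open unit cube `(0,1)^d` in Euclidean space. -/
def openCube (d : ℕ) : Set (EuclideanSpace ℝ (Fin d)) :=
  {x | ∀ i, x i ∈ Ioo (0 : ℝ) 1}

theorem isCompact_cube (d : ℕ) : IsCompact (cube d) := by
  have h : cube d = (EuclideanSpace.equiv (Fin d) ℝ).toHomeomorph ⁻¹'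
      (Set.univ.pi fun _ => Icc (0 : ℝ) 1) := by
    ext x
    simp [cube, Pi.le_def, forall_and]
  rw [h, Homeomorph.isCompact_preimage]
  exact isCompact_univ_pi fun _ => isCompact_Icc

/-- Compactness of the cube equips `C(cube d, ℝ)` with the supremum metric. -/
instance (d : ℕ) : CompactSpace (cube d) :=
  isCompact_iff_compactSpace.mp (isCompact_cube d)

/-- The space `Lip₁([0,1]^d)` of 1-Lipschitz functions `[0,1]^d → ℝ` (with respect to the Euclidean
norm), with the metric `ρ(f,g) = ‖g - f‖_∞` inherited from `C([0,1]^d, ℝ)`. -/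
abbrev Lip1 (d : ℕ) : Type :=
  {f : C(cube d, ℝ) // LipschitzWith 1 f}

/-- `f : [0,1]^d → ℝ` extended by zero to the whole space. Differentiability at a point of the open
cube does not depend on the values outside the closed cube. -/
noncomputable def zeroExtend {d : ℕ} (f : cube d → ℝ) : EuclideanSpace ℝ (Fin d) → ℝ :=
  Function.extend Subtype.val f 0

/-- `F` has every portion of positive measure: each nonempty relatively open subset of `F` has
positive (outer) Lebesgue measure. -/
def EveryPortionPositive (F : Set ℝ) : Prop :=
  ∀ U : Set ℝ, IsOpen U → (U ∩ F).Nonempty → 0 < volume (U ∩ F)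

/-- `E` is a relatively residual subset of `F`. -/
def RelativelyResidual (E F : Set ℝ) : Prop :=
  E ⊆ F ∧ {t : F | (t : ℝ) ∈ E} ∈ residual F

/-- The restriction of `γ` to `[0,1]` is a Lipschitz curve with Lipschitz constant `K`: it is
`K`-Lipschitz and its derivative is bounded away from zero in norm almost everywhere on `[0,1]`
(`derivWithin` is `0` at points of non-differentiability, which are therefore excluded by the
bound). -/
def IsLipschitzCurve {d : ℕ} (K : NNReal) (γ : ℝ → EuclideanSpace ℝ (Fin d)) : Prop :=
  LipschitzOnWith K γ (Icc 0 1) ∧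
    ∃ c : ℝ, 0 < c ∧ ∀ᵐ t ∂(volume.restrict (Icc (0 : ℝ) 1)), c ≤ ‖derivWithin γ (Icc 0 1) t‖

end TypicalLip

open Set MeasureTheory Topology

namespace TypicalLip

/-! For a `1`-Lipschitz `f` the lag `s - f (γ s)` is nondecreasing, and `f ∘ γ` has derivative `1`
exactly where the lag has derivative `0`. Residuality comes from a strategy in a Banach–Mazur game
(`residual_of_strategy`). A position consists of an interval and an open set of functions, each
having a point of `F` in the interval with lag quotients bounded by a tolerance, which is halved at
every move. That point depends on the function; only in the limit do the nested intervals single out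
one parameter.

To answer a move, a function is bent by cones so as to climb at nearly unit slope through some `t'`
in `F` (`exists_small_lag_perturbation`). This is possible because `γ` runs at nearly unit speed
across points of `F`, uniformly on some portion by Baire category
(`exists_uniformly_steep_portion`). All functions in a small ball around the result have tiny total
lag on an interval about `t'`, so by `volume_setOf_large_quotient_le` their bad points have less
measure than `F` has near the density point `t'`: each of them keeps a good point in `F`.

The lag bounds between consecutive scales give derivative `1` at the limit parameter, and the open
sets `O n` force it into the residual set. Finally, unit growth in a unit direction determines the
gradient of a `1`-Lipschitz function (`hasGradientAt_of_hasDerivAt_one`). -/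

/-! ### Banach–Mazur games -/

/-- A maximal disjoint family of admissible answers to a position of a Banach–Mazur game has dense
union. -/
theorem exists_disjoint_dense_answers {X S : Type*} [TopologicalSpace X] (V : S → Set X)
    (W : Set X) (hW : IsOpen W) (A : Set S)
    (step : ∀ U, IsOpen U → U.Nonempty → U ⊆ W → ∃ s ∈ A, (V s).Nonempty ∧ V s ⊆ U) :
    ∃ C ⊆ A, (∀ s ∈ C, V s ⊆ W) ∧ C.PairwiseDisjoint V ∧ W ⊆ closure (⋃ s ∈ C, V s) := by
  obtain ⟨C, hC⟩ := zorn_subset {C : Set S | C ⊆ A ∧ (∀ s ∈ C, V s ⊆ W) ∧ C.PairwiseDisjoint V} (by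
    intro c hc hchain
    refine ⟨⋃₀ c, ⟨sUnion_subset fun t ht => (hc ht).1, ?_, ?_⟩, fun s hs => subset_sUnion_of_mem hs⟩
    · rintro s ⟨t, ht, hs⟩
      exact (hc ht).2.1 s hs
    · exact (pairwiseDisjoint_sUnion hchain.directedOn).2 fun t ht => (hc ht).2.2)
  obtain ⟨hCA, hCW, hCd⟩ := hC.prop
  refine ⟨C, hCA, hCW, hCd, fun x hx => ?_⟩
  by_contra hxc
  -- An answer played off the closure of the union could be added to the maximal family.
  obtain ⟨s, hsA, ⟨y, hy⟩, hsU⟩ := step (W ∩ (closure (⋃ s ∈ C, V s))ᶜ)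
    (hW.inter isClosed_closure.isOpen_compl) ⟨x, hx, hxc⟩ inter_subset_left
  have hdis : ∀ t ∈ C, Disjoint (V s) (V t) := fun t ht =>
    disjoint_left.2 fun z hz hzt => (hsU hz).2 (subset_closure (mem_biUnion ht hzt))
  have hmem : insert s C ∈ {C : Set S | C ⊆ A ∧ (∀ s ∈ C, V s ⊆ W) ∧ C.PairwiseDisjoint V} := by
    refine ⟨insert_subset hsA hCA, ?_, hCd.insert fun t ht _ => hdis t ht⟩
    rintro t (rfl | ht)
    · exact hsU.trans inter_subset_left
    · exact hCW t ht
  have hsC : s ∈ C := hC.le_of_ge hmem (subset_insert s C) (mem_insert s C)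
  exact (hsU hy).2 (subset_closure (mem_biUnion hsC hy))

/-- If the second player of a Banach–Mazur game has a strategy `step`, then residually many points
belong to all sets of some run of the game played according to that strategy. -/
theorem residual_of_strategy {X S : Type*} [TopologicalSpace X] (V : S → Set X)
    (hV : ∀ s, IsOpen (V s)) (R : S → S → Prop) (s₀ : S) (h₀ : V s₀ = univ)
    (step : ∀ s U, IsOpen U → U.Nonempty → U ⊆ V s → ∃ s', R s s' ∧ (V s').Nonempty ∧ V s' ⊆ U) :
    {x | ∃ σ : ℕ → S, σ 0 = s₀ ∧ ∀ n, R (σ n) (σ (n + 1)) ∧ x ∈ V (σ n)} ∈ residual X := by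
  choose C hCR hCV hCd hCc using fun s =>
    exists_disjoint_dense_answers V (V s) (hV s) {s' | R s s'} (step s)
  let L : ℕ → Set S := fun n => Nat.rec {s₀} (fun _ T => ⋃ s ∈ T, C s) n
  have hLs : ∀ n, L (n + 1) = ⋃ s ∈ L n, C s := fun n => rfl
  have hLd : ∀ n, (L n).PairwiseDisjoint V := by
    intro n
    induction n with
    | zero => exact pairwiseDisjoint_singleton s₀ V
    | succ n ih =>
      intro t ht t' ht' hne
      rw [hLs, mem_iUnion₂] at ht ht'
      obtain ⟨s, hs, hst⟩ := ht
      obtain ⟨s', hs', hst'⟩ := ht'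
      by_cases h : s = s'
      · subst h
        exact hCd s hst hst' hne
      · exact (ih hs hs' h).mono (hCV s t hst) (hCV s' t' hst')
  have hdense : ∀ n, Dense (⋃ s ∈ L n, V s) := by
    intro n
    induction n with
    | zero => simp [L, h₀]
    | succ n ih =>
      refine dense_iff_closure_eq.2 (eq_univ_of_univ_subset ?_)
      rw [← ih.closure_eq]
      refine closure_minimal (iUnion₂_subset fun s hs => (hCc s).trans (closure_mono ?_))
        isClosed_closure
      exact iUnion₂_subset fun t ht => subset_biUnion_of_mem (u := V)
        (show t ∈ L (n + 1) from mem_biUnion hs ht)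
  refine Filter.mem_of_superset (countable_iInter_mem.2 fun n =>
    residual_of_dense_open (isOpen_biUnion fun s _ => hV s) (hdense n)) fun x hx => ?_
  have hx' : ∀ n, ∃ s ∈ L n, x ∈ V s := fun n => by simpa using mem_iInter.1 hx n
  choose σ hσL hσx using hx'
  refine ⟨σ, hσL 0, fun n => ⟨?_, hσx n⟩⟩
  obtain ⟨s, hs, hsC⟩ := mem_iUnion₂.1 (hσL (n + 1))
  -- Disjointness within a level makes the independently chosen `σ n` fit together into one run.
  have : s = σ n := by
    by_contra hne
    exact disjoint_left.1 (hLd n hs (hσL n) hne) (hCV s _ hsC (hσx (n + 1))) (hσx n)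
  subst this
  exact hCR _ hsC

/-! ### A maximal inequality for monotone functions -/

/-- A weak-type maximal inequality: a continuous monotone function with small total increment has
small difference quotients at all points off a set of small measure. -/
theorem volume_setOf_large_quotient_le {h : ℝ → ℝ} (hm : Monotone h) (hc : Continuous h)
    {a b ε : ℝ} (hε : 0 < ε) :
    volume {t ∈ Icc a b | ∃ s ∈ Icc a b, ε * |s - t| < |h s - h t|} ≤
      ENNReal.ofReal (4 * (h b - h a) / ε) := by
  let H : StieltjesFunction ℝ := ⟨h, hm, fun x => hc.continuousWithinAt⟩
  have hleft : ∀ x, Function.leftLim h x = h x := fun x =>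
    leftLim_eq_of_tendsto
      ((hc.tendsto x).mono_left nhdsWithin_le_nhds)
  have hball : ∀ x r : ℝ, H.measure (Metric.closedBall x r) =
      ENNReal.ofReal (h (x + r) - h (x - r)) := by
    intro x r
    rw [Real.closedBall_eq_Icc, H.measure_Icc]
    exact congrArg (fun z => ENNReal.ofReal (h (x + r) - z)) (hleft (x - r))
  set B := {t ∈ Icc a b | ∃ s ∈ Icc a b, ε * |s - t| < |h s - h t|} with hB
  have hch : ∀ t ∈ B, ∃ p : ℝ × ℝ, t ∈ Metric.closedBall p.1 p.2 ∧ 0 < p.2 ∧ p.2 ≤ b - a ∧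
      Metric.closedBall p.1 p.2 ⊆ Icc a b ∧ ε * (2 * p.2) ≤ h (p.1 + p.2) - h (p.1 - p.2) := by
    rintro t ⟨ht, s, hs, hst⟩
    have hne : s ≠ t := by
      rintro rfl
      simp at hst
    rcases lt_or_gt_of_ne hne with hlt | hlt
    · refine ⟨((s + t) / 2, (t - s) / 2), ?_, by simp; linarith, by
        simp; linarith [ht.2, hs.1], ?_, ?_⟩
      · rw [Real.closedBall_eq_Icc]; constructor <;> simp <;> linarith
      · rw [Real.closedBall_eq_Icc]; apply Icc_subset_Icc <;> simp <;> linarith [ht.2, hs.1]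
      · rw [abs_of_neg (by linarith), abs_of_nonpos (by linarith [hm hlt.le])] at hst
        have e1 : (s + t) / 2 + (t - s) / 2 = t := by ring
        have e2 : (s + t) / 2 - (t - s) / 2 = s := by ring
        simp only [e1, e2]
        linarith
    · refine ⟨((s + t) / 2, (s - t) / 2), ?_, by simp; linarith, by
        simp; linarith [ht.1, hs.2], ?_, ?_⟩
      · rw [Real.closedBall_eq_Icc]; constructor <;> simp <;> linarith
      · rw [Real.closedBall_eq_Icc]; apply Icc_subset_Icc <;> simp <;> linarith [ht.1, hs.2]
      · rw [abs_of_pos (by linarith), abs_of_nonneg (by linarith [hm hlt.le])] at hst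
        have e1 : (s + t) / 2 + (s - t) / 2 = s := by ring
        have e2 : (s + t) / 2 - (s - t) / 2 = t := by ring
        simp only [e1, e2]
        linarith
  choose! p hpt hp0 hpR hpI hpε using hch
  obtain ⟨u, huB, hud, hucov⟩ := Vitali.exists_disjoint_subfamily_covering_enlargement_closedBall
    B (fun t => (p t).1) (fun t => (p t).2) (b - a) hpR 4 (by norm_num)
  have hucount : u.Countable := by
    refine hud.countable_of_nonempty_interior fun t ht => ?_
    rw [interior_closedBall _ (hp0 t (huB ht)).ne']
    exact Metric.nonempty_ball.2 (hp0 t (huB ht))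
  have : Countable u := hucount.to_subtype
  calc volume B ≤ volume (⋃ t ∈ u, Metric.closedBall (p t).1 (4 * (p t).2)) := by
        refine measure_mono fun t ht => ?_
        obtain ⟨s, hs, hsub⟩ := hucov t ht
        exact mem_biUnion hs (hsub (hpt t ht))
    _ ≤ ∑' t : u, volume (Metric.closedBall (p t).1 (4 * (p t).2)) := measure_biUnion_le _ hucount _
    -- The enlarged ball has length `8 * r`, while the ball itself has `H`-measure at least `ε * (2
    -- * r)`.
    _ ≤ ∑' t : u, ENNReal.ofReal (4 / ε) * H.measure (Metric.closedBall (p t).1 (p t).2) := by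
        refine ENNReal.tsum_le_tsum fun t => ?_
        rw [Real.volume_closedBall, hball, ← ENNReal.ofReal_mul (by positivity)]
        refine ENNReal.ofReal_le_ofReal ?_
        rw [div_mul_eq_mul_div, le_div_iff₀ hε]
        linarith [hpε t (huB t.2)]
    _ = ENNReal.ofReal (4 / ε) * H.measure (⋃ t ∈ u, Metric.closedBall (p t).1 (p t).2) := by
        rw [ENNReal.tsum_mul_left, measure_biUnion hucount hud
          fun t _ => Metric.isClosed_closedBall.measurableSet]
    _ ≤ ENNReal.ofReal (4 / ε) * H.measure (Icc a b) := by
        gcongr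
        exact iUnion₂_subset fun t ht => hpI t (huB ht)
    _ = ENNReal.ofReal (4 * (h b - h a) / ε) := by
        rw [H.measure_Icc, show Function.leftLim H a = h a from hleft a,
          ← ENNReal.ofReal_mul (by positivity)]
        congr 1
        change 4 / ε * (h b - h a) = _
        ring

/-! ### Lag along a curve and steep perturbations -/

/-- The amount by which a function falls behind unit growth along a curve. -/
def lag {X : Type*} (γ : ℝ → X) (f : X → ℝ) (s : ℝ) : ℝ := s - f (γ s)

theorem abs_lag_sub_lag_le {X : Type*} {γ : ℝ → X} {f f' : X → ℝ} {δ : ℝ} (h : ∀ x, |f' x - f x| ≤ δ) (s t : ℝ) :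
    |lag γ f' s - lag γ f' t| ≤ |lag γ f s - lag γ f t| + 2 * δ := by
  have h2 : lag γ f' s - lag γ f' t =
      (lag γ f s - lag γ f t) - (f' (γ s) - f (γ s)) + (f' (γ t) - f (γ t)) := by
    unfold lag; ring
  rw [h2]
  linarith [abs_add_le ((lag γ f s - lag γ f t) - (f' (γ s) - f (γ s))) (f' (γ t) - f (γ t)),
    abs_sub (lag γ f s - lag γ f t) (f' (γ s) - f (γ s)), h (γ s), h (γ t)]

section Lag

variable {X : Type*} [PseudoMetricSpace X]

variable {γ : ℝ → X} {f : X → ℝ}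

theorem abs_comp_sub_le (hγ : LipschitzWith 1 γ) (hf : LipschitzWith 1 f) (s t : ℝ) :
    |f (γ s) - f (γ t)| ≤ |s - t| := by
  have h := (hf.comp hγ).dist_le_mul s t
  simpa [Real.dist_eq] using h

theorem monotone_lag (hγ : LipschitzWith 1 γ) (hf : LipschitzWith 1 f) : Monotone (lag γ f) := by
  intro s t hst
  have h := (abs_le.1 (abs_comp_sub_le hγ hf s t)).1
  rw [abs_of_nonpos (by linarith)] at h
  unfold lag
  linarith

theorem continuous_lag (hγ : LipschitzWith 1 γ) (hf : LipschitzWith 1 f) :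
    Continuous (lag γ f) :=
  continuous_id.sub (hf.continuous.comp hγ.continuous)

theorem abs_lag_sub_le (hγ : LipschitzWith 1 γ) (hf : LipschitzWith 1 f) (s t : ℝ) :
    |lag γ f s - lag γ f t| ≤ 2 * |s - t| := by
  have h := abs_comp_sub_le hγ hf s t
  have h2 : lag γ f s - lag γ f t = (s - t) - (f (γ s) - f (γ t)) := by unfold lag; ring
  rw [h2]
  linarith [abs_sub (s - t) (f (γ s) - f (γ t))]

/-- Downward cones are `1`-Lipschitz, and so is a pointwise bounded supremum of them; this is the
source of all perturbations. -/
theorem lipschitzWith_iSup_sub_dist {ι : Type*} [Nonempty ι] {c : ι → ℝ} (p : ι → X)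
    (hc : BddAbove (range c)) : LipschitzWith 1 fun x => ⨆ i, (c i - dist x (p i)) := by
  have hb : ∀ x, BddAbove (range fun i => c i - dist x (p i)) := by
    obtain ⟨M, hM⟩ := hc
    refine fun x => ⟨M, ?_⟩
    rintro _ ⟨i, rfl⟩
    exact (sub_le_self _ dist_nonneg).trans (hM (mem_range_self i))
  refine LipschitzWith.of_le_add fun x y => ciSup_le fun i => ?_
  have h1 := le_ciSup (hb y) i
  have h2 := dist_triangle_left y (p i) x
  linarith

/-- A `1`-Lipschitz function can be changed by at most `2 * η` so that it grows with slope `lam`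
along a given curve, as seen from the point `γ t` at scales up to `η`, if the curve is expanding
enough across `t`. -/
theorem exists_steep_perturbation (hγ : LipschitzWith 1 γ) (hf : LipschitzWith 1 f)
    {t η lam a b : ℝ} (hη : 0 < η) (hlam : lam ≤ 1) (ha : a ≤ t - η) (hb : t + η ≤ b)
    (hreg : ∀ s ∈ Icc a t, ∀ u ∈ Icc t b, lam * (u - s) ≤ dist (γ s) (γ u)) :
    ∃ f' : X → ℝ, LipschitzWith 1 f' ∧ (∀ x, |f' x - f x| ≤ 2 * η) ∧
      (∀ u ∈ Icc t (t + η), f (γ t) + lam * (u - t) ≤ f' (γ u)) ∧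
      (∀ u ∈ Icc t b, min (f (γ u)) (f (γ t) + lam * (u - t)) ≤ f' (γ u)) ∧
      (∀ s ∈ Icc (t - η) t, f' (γ s) ≤ f (γ t) + lam * (s - t)) ∧
      (∀ s ∈ Icc a t, f' (γ s) ≤ max (f (γ s)) (f (γ t) + lam * (s - t))) := by
  have hlip : ∀ s u, s ≤ u → f (γ u) ≤ f (γ s) + (u - s) := by
    intro s u hsu
    have h := (abs_le.1 (abs_comp_sub_le hγ hf u s)).2
    rw [abs_of_nonneg (by linarith)] at h
    linarith
  have hfd : ∀ x y, f x ≤ f y + dist x y := fun x y => by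
    simpa using hf.le_add_mul x y
  have : Nonempty (Icc t (t + η)) := ⟨⟨t, by constructor <;> linarith⟩⟩
  have : Nonempty (Icc (t - η) t) := ⟨⟨t, by constructor <;> linarith⟩⟩
  set c₁ : Icc t (t + η) → ℝ := fun u => f (γ t) + lam * ((u : ℝ) - t) with hc₁
  set c₂ : Icc (t - η) t → ℝ := fun s => -(f (γ t) + lam * ((s : ℝ) - t)) with hc₂
  have hb₁ : BddAbove (range c₁) := by
    refine ⟨f (γ t) + η, ?_⟩
    rintro _ ⟨⟨u, hu⟩, rfl⟩
    simp only [hc₁]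
    nlinarith [hu.1, hu.2]
  have hb₂ : BddAbove (range c₂) := by
    refine ⟨-f (γ t) + η, ?_⟩
    rintro _ ⟨⟨u, hu⟩, rfl⟩
    simp only [hc₂]
    nlinarith [hu.1, hu.2]
  -- `L` pushes `f` up to the line of slope `lam` ahead of `t`, and `-N` pulls it down to that line
  -- behind `t`.
  set L : X → ℝ := fun x => ⨆ u : Icc t (t + η), (c₁ u - dist x (γ u)) with hL
  set N : X → ℝ := fun x => ⨆ s : Icc (t - η) t, (c₂ s - dist x (γ s)) with hN
  have hLl : LipschitzWith 1 L := lipschitzWith_iSup_sub_dist _ hb₁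
  have hNl : LipschitzWith 1 N := lipschitzWith_iSup_sub_dist _ hb₂
  have hL1 : ∀ u ∈ Icc t (t + η), f (γ t) + lam * (u - t) ≤ L (γ u) := by
    intro u hu
    obtain ⟨M, hM⟩ := hb₁
    have h := le_ciSup (f := fun v : Icc t (t + η) => c₁ v - dist (γ u) (γ v)) ⟨M, by
      rintro _ ⟨i, rfl⟩
      exact (sub_le_self _ dist_nonneg).trans (hM (mem_range_self i))⟩ ⟨u, hu⟩
    refine le_trans (le_of_eq ?_) h
    simp [hc₁]
  have hN1 : ∀ s ∈ Icc (t - η) t, -(f (γ t) + lam * (s - t)) ≤ N (γ s) := by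
    intro u hu
    obtain ⟨M, hM⟩ := hb₂
    have h := le_ciSup (f := fun v : Icc (t - η) t => c₂ v - dist (γ u) (γ v)) ⟨M, by
      rintro _ ⟨i, rfl⟩
      exact (sub_le_self _ dist_nonneg).trans (hM (mem_range_self i))⟩ ⟨u, hu⟩
    refine le_trans (le_of_eq ?_) h
    simp [hc₂]
  have hLf : ∀ x, L x ≤ f x + 2 * η := by
    refine fun x => ciSup_le fun ⟨u, hu⟩ => ?_
    have h1 := hlip t u hu.1
    have h2 := hfd (γ u) x
    have h3 := abs_le.1 (abs_comp_sub_le hγ hf t u)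
    rw [abs_of_nonpos (by linarith [hu.1])] at h3
    rw [dist_comm] at h2
    simp only [hc₁]
    nlinarith [hu.1, hu.2]
  have hNf : ∀ x, N x ≤ -f x + 2 * η := by
    refine fun x => ciSup_le fun ⟨u, hu⟩ => ?_
    have h2 := hfd x (γ u)
    have h3 := hlip u t hu.2
    have h4 := abs_le.1 (abs_comp_sub_le hγ hf u t)
    rw [abs_of_nonpos (by linarith [hu.2])] at h4
    simp only [hc₂]
    nlinarith [hu.1, hu.2]
  -- Expansion of `γ` keeps the two modifications apart: a cone with apex ahead of `t` has fallen to
  -- the line by the time it reaches `γ s`.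
  have hLs : ∀ s ∈ Icc a t, L (γ s) ≤ f (γ t) + lam * (s - t) := by
    refine fun s hs => ciSup_le fun ⟨u, hu⟩ => ?_
    have h := hreg s hs u ⟨hu.1, hu.2.trans hb⟩
    simp only [hc₁]
    linarith
  have hNu : ∀ u ∈ Icc t b, N (γ u) ≤ -(f (γ t) + lam * (u - t)) := by
    refine fun u hu => ciSup_le fun ⟨s, hs⟩ => ?_
    have h := hreg s ⟨ha.trans hs.1, hs.2⟩ u hu
    rw [dist_comm] at h
    simp only [hc₂]
    linarith
  refine ⟨fun x => min (max (f x) (L x)) (-N x), ?_, fun x => ?_, fun u hu => ?_, fun u hu => ?_,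
    fun s hs => ?_, fun s hs => ?_⟩
  · simpa using (hf.max hLl).min hNl.neg
  · have h1 := hLf x
    have h2 := hNf x
    rw [abs_le]
    constructor
    · have : f x - 2 * η ≤ min (max (f x) (L x)) (-N x) :=
        le_min (le_max_of_le_left (by linarith)) (by linarith)
      linarith
    · have : min (max (f x) (L x)) (-N x) ≤ f x + 2 * η :=
        min_le_of_left_le (max_le (by linarith) h1)
      linarith
  · exact le_min (le_max_of_le_right (hL1 u hu)) (by linarith [hNu u ⟨hu.1, hu.2.trans hb⟩])
  · exact le_min (le_max_of_le_left (min_le_left _ _))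
      ((min_le_right _ _).trans (by linarith [hNu u hu]))
  · exact min_le_of_right_le (by linarith [hN1 s hs])
  · exact min_le_of_left_le (max_le_max le_rfl (hLs s hs))

/-- The effect of a steep perturbation on the lag: it becomes small at scales up to `η` and does not
become too large at the other scales. -/
theorem exists_small_lag_perturbation (hγ : LipschitzWith 1 γ) (hf : LipschitzWith 1 f)
    {t η ε A a b : ℝ} (hη : 0 < η) (hε : 0 ≤ ε) (hεA : ε ≤ A) (ha : a ≤ t - η) (hb : t + η ≤ b)
    (hreg : ∀ s ∈ Icc a t, ∀ u ∈ Icc t b, (1 - ε) * (u - s) ≤ dist (γ s) (γ u))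
    (hA : ∀ u ∈ Icc a b, η ≤ |u - t| → |lag γ f u - lag γ f t| ≤ A * |u - t|) :
    ∃ f' : X → ℝ, LipschitzWith 1 f' ∧ (∀ x, |f' x - f x| ≤ 2 * η) ∧
      (∀ u ∈ Icc (t - η) (t + η), |lag γ f' u - lag γ f' t| ≤ ε * |u - t|) ∧
      (∀ u ∈ Icc a b, |lag γ f' u - lag γ f' t| ≤ A * |u - t|) := by
  obtain ⟨f', hf', hd, h1, h2, h3, h4⟩ :=
    exists_steep_perturbation hγ hf hη (by linarith : 1 - ε ≤ 1) ha hb hreg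
  have ht : f' (γ t) = f (γ t) := by
    have e1 := h1 t (by constructor <;> linarith)
    have e2 := h3 t (by constructor <;> linarith)
    apply le_antisymm <;> nlinarith
  have hm := monotone_lag hγ hf'
  have hsmall : ∀ u ∈ Icc (t - η) (t + η), |lag γ f' u - lag γ f' t| ≤ ε * |u - t| := by
    intro u hu
    rcases le_total t u with htu | htu
    · rw [abs_of_nonneg (sub_nonneg.2 (hm htu)), abs_of_nonneg (sub_nonneg.2 htu)]
      have := h1 u ⟨htu, hu.2⟩
      simp only [lag, ht]
      linarith
    · rw [abs_of_nonpos (sub_nonpos.2 (hm htu)), abs_of_nonpos (sub_nonpos.2 htu)]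
      have := h3 u ⟨hu.1, htu⟩
      simp only [lag, ht]
      linarith
  refine ⟨f', hf', hd, hsmall, fun u hu => ?_⟩
  by_cases hut : |u - t| ≤ η
  · have := abs_le.1 hut
    exact (hsmall u (by constructor <;> linarith)).trans (by gcongr)
  · push Not at hut
    have hAu := hA u hu hut.le
    rcases le_total t u with htu | htu
    · rw [abs_of_nonneg (sub_nonneg.2 (monotone_lag hγ hf htu)),
        abs_of_nonneg (sub_nonneg.2 htu)] at hAu
      rw [abs_of_nonneg (sub_nonneg.2 (hm htu)), abs_of_nonneg (sub_nonneg.2 htu)]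
      have := h2 u ⟨htu, hu.2⟩
      simp only [lag, ht] at hAu ⊢
      rcases min_le_iff.1 this with h | h <;> nlinarith
    · rw [abs_of_nonpos (sub_nonpos.2 (monotone_lag hγ hf htu)),
        abs_of_nonpos (sub_nonpos.2 htu)] at hAu
      rw [abs_of_nonpos (sub_nonpos.2 (hm htu)), abs_of_nonpos (sub_nonpos.2 htu)]
      have := h4 u ⟨hu.1, htu⟩
      simp only [lag, ht] at hAu ⊢
      rcases le_max_iff.1 this with h | h <;> nlinarith

end Lag

/-! ### Density points and uniform steepness -/

/-- By Lebesgue density, `F` eventually fills more than half of a ball of length `2 * r`. -/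
theorem EveryPortionPositive.exists_density_point {F : Set ℝ} (hF : EveryPortionPositive F)
    {W : Set ℝ} (hW : IsOpen W) (hWF : (W ∩ F).Nonempty) :
    ∃ t ∈ W ∩ F, ∃ r₀ : ℝ, 0 < r₀ ∧ ∀ r, 0 < r → r < r₀ →
      ENNReal.ofReal r ≤ volume (F ∩ Metric.closedBall t r) := by
  obtain ⟨t, ht, hlim⟩ := Measure.exists_mem_of_measure_ne_zero_of_ae (hF W hW hWF).ne'
    (ae_restrict_of_ae_restrict_of_subset inter_subset_right
      (Besicovitch.ae_tendsto_measure_inter_div volume F))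
  have hev := hlim.eventually (lt_mem_nhds (ENNReal.one_half_lt_one))
  obtain ⟨r₀, hr₀, hr⟩ := mem_nhdsGT_iff_exists_Ioo_subset.1 hev
  refine ⟨t, ht, r₀, hr₀, fun r h0 h1 => ?_⟩
  have h2 : (2⁻¹ : ENNReal) < volume (F ∩ Metric.closedBall t r) / volume (Metric.closedBall t r) :=
    hr ⟨h0, h1⟩
  rw [Real.volume_closedBall] at h2
  have h3 := ENNReal.mul_le_of_le_div h2.le
  refine le_trans (le_of_eq ?_) h3
  rw [ENNReal.ofReal_mul (by norm_num), ← mul_assoc, ENNReal.ofReal_ofNat,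
    ENNReal.inv_mul_cancel (by norm_num) (by norm_num), one_mul]

section Steep

variable {X : Type*} [PseudoMetricSpace X]

/-- The curve `γ` moves at almost unit speed, up to the factor `1 - ε`, across the parameter `t`
within `[a, b]`. -/
def SteepAcross (γ : ℝ → X) (ε a b t : ℝ) : Prop :=
  ∀ s ∈ Icc a t, ∀ u ∈ Icc t b, (1 - ε) * (u - s) ≤ dist (γ s) (γ u)

/-- A curve that is steep across residually many points of `F` is uniformly steep on a dense set of
portions of `F`. -/
theorem exists_uniformly_steep_portion {γ : ℝ → X} (hγ : Continuous γ) {ε : ℝ} {F : Set ℝ}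
    (hF : IsClosed F) {E : Set F} (hE : E ∈ residual F)
    (hs : ∀ t ∈ E, ∃ r > 0, SteepAcross γ ε (t - r) (t + r) t)
    {W : Set ℝ} (hW : IsOpen W) (hWF : (W ∩ F).Nonempty) :
    ∃ U ⊆ W, IsOpen U ∧ (U ∩ F).Nonempty ∧ ∀ t' ∈ U ∩ F, ∃ r > 0,
      ∀ t ∈ F ∩ Metric.closedBall t' r, SteepAcross γ ε (t' - r) (t' + r) t := by
  have : CompleteSpace F := hF.completeSpace_coe
  obtain ⟨G, hGE, hG, hGd⟩ := mem_residual.1 hE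
  let C : ℕ → Set F := fun m => {t | SteepAcross γ ε (t - 1 / (m + 1)) (t + 1 / (m + 1)) t}
  have hC : ∀ m, IsClosed (C m) := by
    intro m
    -- Measuring offsets from `t` makes the index sets independent of `t`, so closedness follows
    -- from continuity of `γ`.
    have : C m = ⋂ α ∈ Icc (0 : ℝ) (1 / (m + 1)), ⋂ β ∈ Icc (0 : ℝ) (1 / (m + 1)),
        {t : F | (1 - ε) * (α + β) ≤ dist (γ (t - α)) (γ (t + β))} := by
      ext t
      simp only [C, SteepAcross, mem_ofPred_eq, mem_iInter]
      constructor
      · intro h α hα β hβ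
        have := h (t - α) (by constructor <;> linarith [hα.1, hα.2]) (t + β)
          (by constructor <;> linarith [hβ.1, hβ.2])
        refine le_trans (le_of_eq ?_) this
        ring
      · intro h s hs u hu
        have := h (t - s) (by constructor <;> linarith [hs.1, hs.2]) (u - t)
          (by constructor <;> linarith [hu.1, hu.2])
        rw [sub_sub_cancel, add_sub_cancel] at this
        refine le_trans (le_of_eq ?_) this
        ring
    rw [this]
    refine isClosed_biInter fun α _ => isClosed_biInter fun β _ => ?_
    refine isClosed_le continuous_const ?_
    exact (hγ.comp (continuous_subtype_val.sub continuous_const)).dist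
      (hγ.comp (continuous_subtype_val.add continuous_const))
  have hcov : G ⊆ ⋃ m, C m := by
    intro t ht
    obtain ⟨r, hr, h⟩ := hs t (hGE ht)
    obtain ⟨m, hm⟩ := exists_nat_one_div_lt hr
    refine mem_iUnion.2 ⟨m, fun s hs u hu => h s ⟨?_, hs.2⟩ u ⟨hu.1, ?_⟩⟩
    · linarith [hs.1]
    · linarith [hu.2]
  obtain ⟨x, hxW, hxF⟩ := hWF
  obtain ⟨t₀, ht₀, ht₀W⟩ := (hG.dense_iUnion_interior_of_closed hGd hC hcov).exists_mem_open
    (hW.preimage continuous_subtype_val) ⟨⟨x, hxF⟩, hxW⟩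
  obtain ⟨m, hm⟩ := mem_iUnion.1 ht₀
  obtain ⟨U₀, hU₀, hU₀e⟩ := isOpen_induced_iff.1 (isOpen_interior (s := C m))
  refine ⟨U₀ ∩ W, inter_subset_right, hU₀.inter hW, ⟨t₀, ⟨?_, ht₀W⟩, t₀.2⟩, ?_⟩
  · rw [← hU₀e] at hm
    exact hm
  rintro t' ⟨⟨ht'U, -⟩, -⟩
  obtain ⟨r₀, hr₀, hball⟩ := Metric.isOpen_iff.1 hU₀ t' ht'U
  have hm0 : (0 : ℝ) < 1 / (m + 1) := by positivity
  refine ⟨min (r₀ / 2) (1 / (m + 1) / 2), by positivity, fun t ht => ?_⟩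
  have htU : t ∈ U₀ := hball (Metric.mem_ball.2 (lt_of_le_of_lt ht.2
    (by linarith [min_le_left (r₀ / 2) ((1 : ℝ) / (m + 1) / 2)])))
  have htC : (⟨t, ht.1⟩ : F) ∈ C m := interior_subset (by rw [← hU₀e]; exact htU)
  have htd := ht.2
  rw [Real.closedBall_eq_Icc] at htd
  have hle := min_le_right (r₀ / 2) ((1 : ℝ) / (m + 1) / 2)
  refine fun s hs u hu => htC s ⟨?_, hs.2⟩ u ⟨hu.1, ?_⟩
  · simp only
    linarith [hs.1, htd.2]
  · simp only
    linarith [hu.2, htd.1]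

end Steep

/-! ### The strategy -/

section Game

variable {X : Type*} [PseudoMetricSpace X] [CompactSpace X]

/-- A position of the Banach–Mazur game in the space of `1`-Lipschitz functions on `X`: an open set
`nhd` of functions together with an interval on which each of them has, at some point of `F`, lag
quotients at most `tol`, while the curve is steep across the points of `F`. -/
structure Position (γ : ℝ → X) (F : Set ℝ) where
  /-- The number of moves made so far. -/
  stage : ℕ
  /-- The set of functions which are still in play. -/
  nhd : Set {f : C(X, ℝ) // LipschitzWith 1 f}
  /-- The centre of the interval. -/
  center : ℝ
  /-- The radius of the interval. -/
  radius : ℝ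
  /-- The tolerance for lag quotients. -/
  tol : ℝ
  isOpen_nhd : IsOpen nhd
  radius_pos : 0 < radius
  tol_pos : 0 < tol
  steep : ∀ t ∈ F, |t - center| ≤ 3 * radius / 4 →
    SteepAcross γ tol (center - radius) (center + radius) t
  good : ∀ f ∈ nhd, ∃ t ∈ F, |t - center| ≤ radius / 2 ∧
    ∀ s, |s - center| ≤ radius → |lag γ f.1 s - lag γ f.1 t| ≤ tol * |s - t|

/-- The position `Q` is an admissible successor of `P`, aiming at the open sets `O n`. -/
structure Position.Follows {γ : ℝ → X} {F : Set ℝ} (O : ℕ → Set ℝ) (P Q : Position γ F) :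
    Prop where
  stage_eq : Q.stage = P.stage + 1
  tol_eq : Q.tol = P.tol / 2
  radius_le : Q.radius ≤ P.radius / 2
  subset : ∀ s, |s - Q.center| ≤ Q.radius → |s - P.center| ≤ 3 * P.radius / 4
  mem : ∀ s, |s - Q.center| ≤ Q.radius → s ∈ O P.stage
  lag_le : ∀ f ∈ Q.nhd, ∀ t, |t - Q.center| ≤ 3 * Q.radius / 4 → ∀ s, |s - P.center| ≤ P.radius →
    Q.radius ≤ |s - Q.center| → |lag γ f.1 s - lag γ f.1 t| ≤ 25 * P.tol * |s - t|

variable {γ : ℝ → X} {F : Set ℝ}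

theorem abs_apply_sub_le {f g : {f : C(X, ℝ) // LipschitzWith 1 f}} {δ : ℝ} (h : dist f g ≤ δ)
    (x : X) : |f.1 x - g.1 x| ≤ δ := by
  rw [← Real.dist_eq]
  exact (ContinuousMap.dist_apply_le_dist x).trans h

/-- Close to a point of `F` at which a function has small lag quotients there is another point of
`F`, in a prescribed open set, at which a small perturbation of the function has small lag quotients
at all scales and tiny ones at small scales. -/
theorem Position.exists_perturbation (hγ : LipschitzWith 1 γ) (P : Position γ F) {ε₁ κ : ℝ}
    (hε₁ : 0 < ε₁) (hε₁P : ε₁ ≤ P.tol) {O : Set ℝ} (hκ : 0 < κ)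
    (hO : ∀ W, IsOpen W → (W ∩ F).Nonempty → ∃ U ⊆ W ∩ O, IsOpen U ∧ (U ∩ F).Nonempty ∧
      ∀ t' ∈ U ∩ F, ∃ r > 0, ∀ t ∈ F, |t - t'| ≤ r → SteepAcross γ ε₁ (t' - r) (t' + r) t)
    (hF : EveryPortionPositive F) {f : {f : C(X, ℝ) // LipschitzWith 1 f}} (hf : f ∈ P.nhd) :
    ∃ t' ∈ F ∩ O, |t' - P.center| ≤ 5 * P.radius / 8 ∧ ∃ r₀ > 0, ∀ θ, 0 < θ → θ ≤ r₀ →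
      ENNReal.ofReal (θ / 4) ≤ volume (F ∩ Metric.closedBall t' (θ / 4)) ∧
      (∀ t ∈ F, |t - t'| ≤ θ → SteepAcross γ ε₁ (t' - θ) (t' + θ) t) ∧
      ∃ g : {f : C(X, ℝ) // LipschitzWith 1 f}, dist g f ≤ κ ∧
        (∀ s, |s - t'| ≤ θ → |lag γ g.1 s - lag γ g.1 t'| ≤ ε₁ * |s - t'|) ∧
        ∀ s, |s - P.center| ≤ P.radius →
          |lag γ g.1 s - lag γ g.1 t'| ≤ 3 * P.tol * |s - t'| := by
  have hρ := P.radius_pos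
  have hε := P.tol_pos
  have hsteep := P.steep
  have hgood := P.good
  set ρ := P.radius
  set ε := P.tol
  set m := P.center
  obtain ⟨t₁, ht₁F, ht₁m, ht₁⟩ := hgood f hf
  set η := min (κ / 4) (ρ / 8) with hη
  have hη0 : 0 < η := by positivity
  have hηκ : η ≤ κ / 4 := min_le_left _ _
  have hηρ : η ≤ ρ / 8 := min_le_right _ _
  obtain ⟨U, hUW, hUo, hUF, hU⟩ := hO (Metric.ball t₁ (η / 2)) Metric.isOpen_ball
    ⟨t₁, Metric.mem_ball_self (by positivity), ht₁F⟩
  obtain ⟨t', ht'U, r₁, hr₁, hdens⟩ := hF.exists_density_point hUo hUF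
  obtain ⟨r, hr, hrs⟩ := hU t' ht'U
  have ht'1 : |t' - t₁| < η / 2 := (hUW ht'U.1).1
  have ht'm : |t' - m| ≤ 5 * ρ / 8 := by linarith [abs_sub_le t' t₁ m]
  have htm := abs_le.1 ht'm
  -- As `t'` is within `η / 2` of `t₁`, at distances at least `η` the move from `t₁` to `t'` at most
  -- doubles the quotient bound.
  have hfar : ∀ u ∈ Icc (m - ρ) (m + ρ), η ≤ |u - t'| →
      |lag γ f.1 u - lag γ f.1 t'| ≤ 2 * ε * |u - t'| := by
    intro u hu hut
    have h1 := ht₁ u (abs_le.2 ⟨by linarith [hu.1], by linarith [hu.2]⟩)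
    have h2 := ht₁ t' (by linarith)
    have h3 := abs_sub_le (lag γ f.1 u) (lag γ f.1 t₁) (lag γ f.1 t')
    rw [abs_sub_comm (lag γ f.1 t₁)] at h3
    have h4 := abs_sub_le u t' t₁
    nlinarith
  obtain ⟨f₃, hf₃, hf₃f, -, hf₃lag⟩ := exists_small_lag_perturbation hγ f.2 hη0 hε.le
    (by linarith : ε ≤ 2 * ε) (by linarith) (by linarith)
    (hsteep t' ht'U.2 (by linarith)) hfar
  -- Two perturbations follow each other: slope `1 - ε` at scale `η`, then slope `1 - ε₁` at scale
  -- `θ`. The second is controlled only within `r` of `t'`; beyond that it changes lag increments by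
  -- at most `4 * θ ≤ ε * r`, whence the constant `3`.
  refine ⟨t', ⟨ht'U.2, (hUW ht'U.1).2⟩, ht'm, min (min η r₁) (min r (ε * r / 4)),
    by positivity, fun θ hθ hθm => ?_⟩
  simp only [le_min_iff] at hθm
  obtain ⟨⟨hθη, hθr₁⟩, hθr, hθε⟩ := hθm
  refine ⟨hdens _ (by positivity) (by linarith), ?_, ?_⟩
  · intro t ht htt s hs u hu
    exact hrs t ht (htt.trans hθr) s ⟨by linarith [hs.1], hs.2⟩ u ⟨hu.1, by linarith [hu.2]⟩
  obtain ⟨f₄, hf₄, hf₄f, hf₄s, hf₄lag⟩ := exists_small_lag_perturbation hγ hf₃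
    (a := max (t' - r) (m - ρ)) (b := min (t' + r) (m + ρ)) hθ hε₁.le
    (by linarith : ε₁ ≤ 2 * ε) (max_le (by linarith) (by linarith))
    (le_min (by linarith) (by linarith))
    (fun s hs u hu => hrs t' ht'U.2 (by simpa using hr.le) s ⟨(le_max_left _ _).trans hs.1, hs.2⟩
      u ⟨hu.1, hu.2.trans (min_le_left _ _)⟩)
    (fun u hu _ => hf₃lag u ⟨(le_max_right _ _).trans hu.1, hu.2.trans (min_le_right _ _)⟩)
  refine ⟨⟨⟨f₄, hf₄.continuous⟩, hf₄⟩, ?_, ?_, ?_⟩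
  · refine (ContinuousMap.dist_le hκ.le).2 fun x => ?_
    rw [Real.dist_eq]
    have h := abs_sub_le (f₄ x) (f₃ x) (f.1 x)
    have h1 := hf₄f x
    have h2 := hf₃f x
    exact h.trans (by linarith)
  · intro s hs
    have := abs_le.1 hs
    exact hf₄s s ⟨by linarith, by linarith⟩
  · intro s hs
    have hsm := abs_le.1 hs
    change |lag γ f₄ s - lag γ f₄ t'| ≤ _
    have hpos : 0 ≤ ε * |s - t'| := by positivity
    by_cases hsr : |s - t'| ≤ r
    · have hst := abs_le.1 hsr
      have := hf₄lag s ⟨max_le (by linarith) (by linarith), le_min (by linarith) (by linarith)⟩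
      linarith
    · push Not at hsr
      have h1 := abs_lag_sub_lag_le (γ := γ) hf₄f s t'
      have h2 := hf₃lag s ⟨by linarith, by linarith⟩
      have h3 : ε * r ≤ ε * |s - t'| := by gcongr
      linarith

/-- The new position is a ball around the perturbed function, so small that the lag bounds survive.
The good points of its members come from measure, not from `t'` itself. -/
theorem Position.exists_follows (hγ : LipschitzWith 1 γ) (hF : EveryPortionPositive F)
    {O : ℕ → Set ℝ} (hOo : ∀ n, IsOpen (O n))
    (hO : ∀ ε > 0, ∀ n, ∀ W, IsOpen W → (W ∩ F).Nonempty →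
      ∃ U ⊆ W ∩ O n, IsOpen U ∧ (U ∩ F).Nonempty ∧
        ∀ t' ∈ U ∩ F, ∃ r > 0, ∀ t ∈ F, |t - t'| ≤ r → SteepAcross γ ε (t' - r) (t' + r) t)
    (P : Position γ F) {U : Set {f : C(X, ℝ) // LipschitzWith 1 f}} (hUo : IsOpen U)
    (hU : U.Nonempty) (hUP : U ⊆ P.nhd) :
    ∃ Q : Position γ F, P.Follows O Q ∧ Q.nhd.Nonempty ∧ Q.nhd ⊆ U := by
  obtain ⟨f, hfU⟩ := hU
  obtain ⟨κ, hκ, hκU⟩ := Metric.isOpen_iff.1 hUo f hfU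
  have hε := P.tol_pos
  have hρ := P.radius_pos
  set ε := P.tol
  set ρ := P.radius
  obtain ⟨t', ⟨ht'F, ht'O⟩, ht'm, r₀, hr₀, H⟩ := P.exists_perturbation hγ
    (by positivity : 0 < ε / 200) (by linarith) (by positivity : 0 < κ / 2)
    (hO (ε / 200) (by positivity) P.stage) hF (hUP hfU)
  obtain ⟨r₁, hr₁, hr₁O⟩ := Metric.isOpen_iff.1 (hOo P.stage) t' ht'O
  obtain ⟨θ, hθ, hθr₀, hθr₁, hθρ⟩ : ∃ θ, 0 < θ ∧ θ ≤ r₀ ∧ θ < r₁ ∧ θ ≤ ρ / 8 :=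
    ⟨min (min r₀ (r₁ / 2)) (ρ / 8), by positivity,
      (min_le_left _ _).trans (min_le_left _ _), by
        linarith [(min_le_left (min r₀ (r₁ / 2)) (ρ / 8)).trans (min_le_right _ _)],
      min_le_right _ _⟩
  obtain ⟨hdens, hsteep, g, hgf, hgs, hgl⟩ := H θ hθ hθr₀
  obtain ⟨δ, hδ, hδκ, hδε⟩ : ∃ δ, 0 < δ ∧ δ ≤ κ / 2 ∧ δ ≤ ε / 200 * θ :=
    ⟨min (κ / 2) (ε / 200 * θ), by positivity, min_le_left _ _, min_le_right _ _⟩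
  have hnear : ∀ f' ∈ Metric.ball g δ, ∀ s t,
      |lag γ f'.1 s - lag γ f'.1 t| ≤ |lag γ g.1 s - lag γ g.1 t| + 2 * δ := fun f' hf' =>
    abs_lag_sub_lag_le (abs_apply_sub_le (Metric.mem_ball.1 hf').le)
  have hgood : ∀ f' ∈ Metric.ball g δ, ∃ t ∈ F, |t - t'| ≤ θ / 2 ∧
      ∀ s, |s - t'| ≤ θ → |lag γ f'.1 s - lag γ f'.1 t| ≤ ε / 2 * |s - t| := by
    intro f' hf'
    -- Otherwise all of `F` within `θ / 4` of `t'` is bad. The lag increment over the interval is at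
    -- most `ε * θ / 50`, so the bad set has measure at most `4 * θ / 25`, less than `θ / 4`.
    by_contra! hbad
    have h1 := volume_setOf_large_quotient_le (monotone_lag hγ f'.2) (continuous_lag hγ f'.2)
      (a := t' - θ) (b := t' + θ) (by positivity : 0 < ε / 2)
    have h2 : F ∩ Metric.closedBall t' (θ / 4) ⊆ {t ∈ Icc (t' - θ) (t' + θ) |
        ∃ s ∈ Icc (t' - θ) (t' + θ), ε / 2 * |s - t| < |lag γ f'.1 s - lag γ f'.1 t|} := by
      rintro t ⟨htF, ht⟩
      have ht1 : |t - t'| ≤ θ / 4 := ht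
      have ht2 := abs_le.1 ht1
      obtain ⟨s, hs, hst⟩ := hbad t htF (by linarith)
      have hs2 := abs_le.1 hs
      exact ⟨⟨by linarith, by linarith⟩, s, ⟨by linarith, by linarith⟩, hst⟩
    have h3 := (hdens.trans (measure_mono h2)).trans h1
    have h4 := hnear f' hf' (t' + θ) (t' - θ)
    have h5 := hgs (t' + θ) (by simp [abs_of_pos hθ])
    have h6 := hgs (t' - θ) (by simp [abs_of_pos hθ])
    have h7 := abs_sub_le (lag γ g.1 (t' + θ)) (lag γ g.1 t') (lag γ g.1 (t' - θ))
    rw [abs_sub_comm (lag γ g.1 t')] at h7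
    simp only [add_sub_cancel_left, sub_sub_cancel_left, abs_neg, abs_of_pos hθ] at h5 h6
    have h8 := le_abs_self (lag γ f'.1 (t' + θ) - lag γ f'.1 (t' - θ))
    rw [ENNReal.ofReal_le_ofReal_iff', le_div_iff₀ (by positivity)] at h3
    rcases h3 with h3 | h3
    · have := mul_pos hε hθ
      linarith
    · linarith
  refine ⟨⟨P.stage + 1, Metric.ball g δ, t', θ, ε / 2, Metric.isOpen_ball, hθ, by positivity, ?_,
    hgood⟩, ⟨rfl, rfl, ?_, ?_, ?_, ?_⟩, ⟨g, Metric.mem_ball_self hδ⟩, ?_⟩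
  · intro t ht htt s hs u hu
    refine le_trans ?_ (hsteep t ht (by linarith) s hs u hu)
    have : 0 ≤ u - s := by linarith [hs.2, hu.1]
    gcongr
    linarith
  · change θ ≤ ρ / 2
    linarith
  · intro s hs
    change |s - t'| ≤ θ at hs
    change |s - P.center| ≤ 3 * ρ / 4
    linarith [abs_sub_le s t' P.center]
  · intro s hs
    exact hr₁O (Metric.mem_ball.2 (lt_of_le_of_lt hs hθr₁))
  -- Here `|s - t| ≥ θ / 4`, so `s` and `t` lie within `4 * |s - t|` and `3 * |s - t|` of `t'`. This
  -- gives `3 * (4 + 3) = 21`, and `25` leaves room for `2 * δ`.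
  · intro f' hf' t ht s hs hst
    change |t - t'| ≤ 3 * θ / 4 at ht
    change θ ≤ |s - t'| at hst
    have h1 := hnear f' hf' s t
    have h2 := abs_sub_le (lag γ g.1 s) (lag γ g.1 t') (lag γ g.1 t)
    rw [abs_sub_comm (lag γ g.1 t')] at h2
    have h3 := hgl s hs
    have h4 := hgl t (by linarith [abs_sub_le t t' P.center])
    have h5 := abs_sub_le s t t'
    have h6 : ε * θ ≤ ε * (4 * |s - t|) := by
      gcongr
      linarith
    have h7 : ε * |s - t'| ≤ ε * (4 * |s - t|) := by
      gcongr
      linarith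
    have h8 : ε * |t - t'| ≤ ε * (3 * |s - t|) := by
      gcongr
      linarith
    linarith
  · intro f' hf'
    refine hκU (Metric.mem_ball.2 ?_)
    linarith [dist_triangle f' g f, Metric.mem_ball.1 hf']

end Game

/-! ### The limit of a run -/

section Typical

variable {X : Type*} [PseudoMetricSpace X] [CompactSpace X] {γ : ℝ → X} {F : Set ℝ}

/-- Every run of the game determines a point of `F` at which the functions remaining in play have
derivative `1` along the curve. -/
theorem Position.exists_hasDerivAt_of_run (hF : IsClosed F) {O : ℕ → Set ℝ}
    {σ : ℕ → Position γ F} (h0 : (σ 0).stage = 0) (hσ : ∀ n, (σ n).Follows O (σ (n + 1)))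
    {f : {f : C(X, ℝ) // LipschitzWith 1 f}} (hf : ∀ n, f ∈ (σ n).nhd) :
    ∃ t ∈ F, (∀ n, t ∈ O n) ∧ HasDerivAt (fun s => f.1 (γ s)) 1 t := by
  have hstage : ∀ n, (σ n).stage = n := by
    intro n
    induction n with
    | zero => exact h0
    | succ n ih => rw [(hσ n).stage_eq, ih]
  have htol : ∀ n, (σ n).tol = (σ 0).tol * (1 / 2) ^ n := by
    intro n
    induction n with
    | zero => simp
    | succ n ih => rw [(hσ n).tol_eq, ih]; ring
  have hrad : ∀ n, (σ n).radius ≤ (σ 0).radius * (1 / 2) ^ n := by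
    intro n
    induction n with
    | zero => simp
    | succ n ih =>
      rw [pow_succ]
      linarith [(hσ n).radius_le]
  have hlim : ∀ c : ℝ, Filter.Tendsto (fun n : ℕ => c * (1 / 2) ^ n) Filter.atTop (𝓝 0) := by
    intro c
    simpa using (tendsto_pow_atTop_nhds_zero_of_lt_one (r := (1 / 2 : ℝ)) (by norm_num)
      (by norm_num)).const_mul c
  obtain ⟨t, ht⟩ := IsCompact.nonempty_iInter_of_sequence_nonempty_isCompact_isClosed
    (fun n => F ∩ Metric.closedBall (σ n).center (σ n).radius)
    (fun n s hs => ⟨hs.1, ((hσ n).subset s hs.2).trans (by linarith [(σ n).radius_pos])⟩)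
    (fun n => by
      obtain ⟨s, hs, hsc, -⟩ := (σ n).good f (hf n)
      exact ⟨s, hs, hsc.trans (by linarith [(σ n).radius_pos])⟩)
    ((isCompact_closedBall _ _).inter_left hF)
    (fun n => hF.inter Metric.isClosed_closedBall)
  rw [mem_iInter] at ht
  have htc : ∀ n, |t - (σ n).center| ≤ (σ n).radius := fun n => (ht n).2
  have htc' : ∀ n, |t - (σ n).center| ≤ 3 * (σ n).radius / 4 := fun n =>
    (hσ n).subset t (htc (n + 1))
  refine ⟨t, (ht 0).1, fun n => hstage n ▸ (hσ n).mem t (htc (n + 1)), ?_⟩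
  rw [hasDerivAt_iff_isLittleO, Asymptotics.isLittleO_iff]
  intro c hc
  obtain ⟨N, hN⟩ := ((hlim (25 * (σ 0).tol)).eventually_lt_const hc).exists
  filter_upwards [Metric.closedBall_mem_nhds t
    (show 0 < (σ N).radius / 4 by linarith [(σ N).radius_pos])] with s hs
  have hs' : |s - t| ≤ (σ N).radius / 4 := hs
  rcases eq_or_ne s t with rfl | hst
  · simp
  -- The last interval before `s` drops out; shrinking radii force this since `s ≠ t`.
  obtain ⟨n, hNn, hn, hn'⟩ : ∃ n, N ≤ n ∧ |s - (σ n).center| ≤ (σ n).radius ∧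
      (σ (n + 1)).radius < |s - (σ (n + 1)).center| := by
    by_contra! hall
    have hin : ∀ k, |s - (σ (N + k)).center| ≤ (σ (N + k)).radius := by
      intro k
      induction k with
      | zero => exact (abs_sub_le s t _).trans (by rw [add_zero]; linarith [htc' N])
      | succ k ih => exact hall (N + k) (Nat.le_add_right _ _) ih
    obtain ⟨k, hk, hkN⟩ := (((hlim (2 * (σ 0).radius)).eventually_lt_const
      (abs_pos.2 (sub_ne_zero.2 hst))).and (Filter.eventually_ge_atTop N)).exists
    obtain ⟨j, rfl⟩ := Nat.exists_eq_add_of_le hkN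
    have h1 := abs_sub_le s (σ (N + j)).center t
    rw [abs_sub_comm (σ (N + j)).center t] at h1
    linarith [hin j, htc (N + j), hrad (N + j)]
  have h := (hσ n).lag_le f (hf (n + 1)) t (htc' (n + 1)) s hn hn'.le
  have hmono : (1 / 2 : ℝ) ^ n ≤ (1 / 2) ^ N :=
    pow_le_pow_of_le_one (by norm_num) (by norm_num) hNn
  have htoln : 25 * (σ n).tol ≤ c := by
    rw [htol n]
    nlinarith [(σ 0).tol_pos]
  rw [Real.norm_eq_abs, Real.norm_eq_abs, abs_sub_comm, smul_eq_mul, mul_one]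
  refine le_trans (le_of_eq ?_) (h.trans (by gcongr))
  unfold lag
  congr 1
  ring

/-- A typical `1`-Lipschitz function on `X` has derivative `1` along the curve `γ` at some point of
a residual subset of `F`, if the curve is infinitesimally steep at all points of that subset. -/
theorem residual_setOf_hasDerivAt_one (hγ : LipschitzWith 1 γ) (hFne : F.Nonempty)
    (hFc : IsClosed F) (hF : EveryPortionPositive F) {E : Set F} (hE : E ∈ residual F)
    (hs : ∀ t ∈ E, ∀ ε > 0, ∃ r > 0, SteepAcross γ ε (t - r) (t + r) t) :
    {f : {f : C(X, ℝ) // LipschitzWith 1 f} | ∃ t ∈ E, HasDerivAt (fun s => f.1 (γ s)) 1 t} ∈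
      residual {f : C(X, ℝ) // LipschitzWith 1 f} := by
  have : CompleteSpace F := hFc.completeSpace_coe
  obtain ⟨G, hGE, hG, hGd⟩ := mem_residual.1 hE
  obtain ⟨G', hG', rfl⟩ := isGδ_iff_eq_iInter_nat.1 hG
  choose O hOo hOG using fun n => isOpen_induced_iff.1 (hG' n)
  have hO : ∀ ε > 0, ∀ n, ∀ W, IsOpen W → (W ∩ F).Nonempty →
      ∃ U ⊆ W ∩ O n, IsOpen U ∧ (U ∩ F).Nonempty ∧
        ∀ t' ∈ U ∩ F, ∃ r > 0, ∀ t ∈ F, |t - t'| ≤ r → SteepAcross γ ε (t' - r) (t' + r) t := by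
    rintro ε hε n W hW ⟨x, hxW, hxF⟩
    obtain ⟨y, hy, hyW⟩ := (hGd.mono (iInter_subset G' n)).exists_mem_open
      (hW.preimage continuous_subtype_val) ⟨⟨x, hxF⟩, hxW⟩
    rw [← hOG n] at hy
    obtain ⟨U, hUW, hU, hUF, h⟩ := exists_uniformly_steep_portion hγ.continuous hFc hE
      (fun t ht => hs t ht ε hε) (hW.inter (hOo n)) ⟨y, ⟨hyW, hy⟩, y.2⟩
    refine ⟨U, hUW, hU, hUF, fun t' ht' => ?_⟩
    obtain ⟨r, hr, hr'⟩ := h t' ht'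
    exact ⟨r, hr, fun t ht htt => hr' t ⟨ht, htt⟩⟩
  obtain ⟨x, hx⟩ := hFne
  -- Tolerance `2` makes the opening position free: the lag is `2`-Lipschitz, and steepness with
  -- factor `1 - 2 < 0` is vacuous.
  let P₀ : Position γ F :=
    { stage := 0
      nhd := univ
      center := x
      radius := 1
      tol := 2
      isOpen_nhd := isOpen_univ
      radius_pos := one_pos
      tol_pos := two_pos
      steep := fun t _ _ s hs u hu =>
        le_trans (by linarith [hs.2, hu.1]) dist_nonneg
      good := fun f _ => ⟨x, hx, by simp, fun s _ => abs_lag_sub_le hγ f.2 s x⟩ }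
  refine Filter.mem_of_superset (residual_of_strategy Position.nhd Position.isOpen_nhd
    (Position.Follows O) P₀ rfl fun P U hUo hU hUP => P.exists_follows hγ hF hOo hO hUo hU hUP) ?_
  rintro f ⟨σ, hσ0, hσ⟩
  obtain ⟨t, htF, htO, ht⟩ := Position.exists_hasDerivAt_of_run hFc (by rw [hσ0])
    (fun n => (hσ n).1) (fun n => (hσ n).2)
  refine ⟨⟨t, htF⟩, hGE (mem_iInter.2 fun n => ?_), ht⟩
  rw [← hOG n]
  exact htO n

end Typical

/-! ### From unit growth along the curve to the gradient -/

section Gradient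

variable {H : Type*} [NormedAddCommGroup H] [InnerProductSpace ℝ H]

open scoped InnerProductSpace

/-- The square of the right side exceeds that of the left by `(⟪v, h⟫ + ‖h‖ ^ 2 / (2 * s)) ^ 2`; the
bound `‖h‖ ≤ s` makes the right side nonnegative. -/
theorem norm_smul_add_le {v h : H} (hv : ‖v‖ = 1) {s : ℝ} (hs : 0 < s) (hh : ‖h‖ ≤ s) :
    ‖s • v + h‖ ≤ s + ⟪v, h⟫_ℝ + ‖h‖ ^ 2 / (2 * s) := by
  have h1 : |⟪v, h⟫_ℝ| ≤ ‖h‖ := by simpa [hv] using abs_real_inner_le_norm v h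
  have h2 := (abs_le.1 h1).1
  have h3 : 0 ≤ ‖h‖ ^ 2 / (2 * s) := by positivity
  refine le_of_sq_le_sq ?_ (by linarith)
  rw [norm_add_sq_real, norm_smul, hv, inner_smul_left, Real.norm_eq_abs, mul_one, sq_abs]
  have h4 : 2 * s * (‖h‖ ^ 2 / (2 * s)) = ‖h‖ ^ 2 := by field_simp
  simp only [conj_trivial]
  nlinarith [sq_nonneg (⟪v, h⟫_ℝ + ‖h‖ ^ 2 / (2 * s))]

/-- A `1`-Lipschitz function with derivative `1` along a curve with unit velocity `v` has
gradient `v`. -/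
theorem hasGradientAt_of_hasDerivAt_one [CompleteSpace H] {f : H → ℝ} {C : Set H}
    (hf : LipschitzOnWith 1 f C) {γ : ℝ → H} {t : ℝ} {v : H} (hC : C ∈ 𝓝 (γ t)) (hv : ‖v‖ = 1)
    (hγ : HasDerivAt γ v t) (hd : HasDerivAt (fun s => f (γ s)) 1 t) :
    HasGradientAt f v (γ t) := by
  have hfC : ∀ x ∈ C, ∀ y ∈ C, |f x - f y| ≤ ‖x - y‖ := fun x hx y hy => by
    simpa [Real.dist_eq, dist_eq_norm] using hf.dist_le_mul x hx y hy
  have hline : ∀ ε > 0, ∀ᶠ s : ℝ in 𝓝 0,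
      γ t + s • v ∈ C ∧ |f (γ t + s • v) - f (γ t) - s| ≤ ε * |s| := by
    intro ε hε
    have h1 := (Asymptotics.isLittleO_iff.1 (hasDerivAt_iff_isLittleO_nhds_zero.1 hγ))
      (half_pos hε)
    have h2 := (Asymptotics.isLittleO_iff.1 (hasDerivAt_iff_isLittleO_nhds_zero.1 hd))
      (half_pos hε)
    have h3 : ∀ᶠ s : ℝ in 𝓝 0, γ (t + s) ∈ C := by
      refine Filter.Tendsto.eventually ?_ hC
      have : ContinuousAt (fun s : ℝ => γ (t + s)) 0 :=
        ContinuousAt.comp (by simpa using hγ.continuousAt) (by fun_prop)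
      simpa [ContinuousAt] using this
    have h4 : ∀ᶠ s : ℝ in 𝓝 0, γ t + s • v ∈ C := by
      refine Filter.Tendsto.eventually ?_ hC
      have : ContinuousAt (fun s : ℝ => γ t + s • v) 0 := by fun_prop
      simpa [ContinuousAt] using this
    filter_upwards [h1, h2, h3, h4] with s h1 h2 h3 h4
    refine ⟨h4, ?_⟩
    have h5 := hfC _ h4 _ h3
    rw [← norm_neg] at h1
    have e : -(γ (t + s) - γ t - s • v) = γ t + s • v - γ (t + s) := by abel
    rw [e] at h1
    simp only [Real.norm_eq_abs, smul_eq_mul, mul_one] at h1 h2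
    have h6 := abs_add_le (f (γ t + s • v) - f (γ (t + s))) (f (γ (t + s)) - f (γ t) - s)
    have e2 : f (γ t + s • v) - f (γ (t + s)) + (f (γ (t + s)) - f (γ t) - s) =
      f (γ t + s • v) - f (γ t) - s := by ring
    rw [e2] at h6
    linarith
  rw [hasGradientAt_iff_isLittleO_nhds_zero, Asymptotics.isLittleO_iff]
  intro c' hc'
  obtain ⟨c, hc, hcc', hc1⟩ : ∃ c, 0 < c ∧ c ≤ c' ∧ c ≤ 1 :=
    ⟨min c' 1, by positivity, min_le_left _ _, min_le_right _ _⟩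
  obtain ⟨δ, hδ, hδs⟩ := Metric.eventually_nhds_iff.1 (hline (c ^ 2 / 2) (by positivity))
  have hCh : ∀ᶠ h : H in 𝓝 0, γ t + h ∈ C := by
    refine Filter.Tendsto.eventually ?_ hC
    have : ContinuousAt (fun h : H => γ t + h) 0 := by fun_prop
    simpa [ContinuousAt] using this
  filter_upwards [hCh, Metric.ball_mem_nhds (0 : H) (by positivity : 0 < c * δ)] with h hhC hhδ
  rcases eq_or_ne h 0 with rfl | hne
  · simp
  have hh : 0 < ‖h‖ := norm_pos_iff.2 hne
  rw [mem_ball_zero_iff] at hhδ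
  -- The value at `γ t + h` is squeezed between cones with apexes at `γ t ± s • v`. This `s`
  -- balances the curvature error `‖h‖ ^ 2 / (2 * s)` against the error along the line: each is `c *
  -- ‖h‖ / 2`.
  set s := ‖h‖ / c with hs
  have hcs : c * s = ‖h‖ := by rw [hs]; field_simp
  have hs0 : 0 < s := by positivity
  have hsδ : s < δ := by
    rw [hs, div_lt_iff₀ hc]
    linarith
  have hhs : ‖h‖ ≤ s := by nlinarith
  have hq : ‖h‖ ^ 2 / (2 * s) = c * ‖h‖ / 2 := by
    rw [hs]; field_simp
  obtain ⟨hp, hp'⟩ := hδs (y := s) (by simpa [abs_of_pos hs0] using hsδ)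
  obtain ⟨hm, hm'⟩ := hδs (y := -s) (by simpa [abs_of_pos hs0] using hsδ)
  rw [abs_of_pos hs0] at hp'
  rw [abs_neg, abs_of_pos hs0] at hm'
  have hεs : c ^ 2 / 2 * s = c * ‖h‖ / 2 := by rw [← hcs]; ring
  rw [hεs] at hp' hm'
  have hu := hfC _ hhC _ hm
  have hl := hfC _ hp _ hhC
  have e1 : γ t + h - (γ t + (-s) • v) = s • v + h := by rw [neg_smul]; abel
  have e2 : γ t + s • v - (γ t + h) = s • v + -h := by abel
  rw [e1] at hu
  rw [e2] at hl
  have hu2 := norm_smul_add_le hv hs0 hhs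
  have hl2 := norm_smul_add_le (h := -h) hv hs0 (by rwa [norm_neg])
  rw [hq] at hu2
  rw [norm_neg, inner_neg_right, hq] at hl2
  have hcc : c * ‖h‖ ≤ c' * ‖h‖ := by gcongr
  rw [Real.norm_eq_abs, abs_le]
  have hu3 := abs_le.1 hu
  have hl3 := abs_le.1 hl
  have hp3 := abs_le.1 hp'
  have hm3 := abs_le.1 hm'
  constructor <;> linarith

theorem exists_steepAcross_of_hasDerivAt {γ : ℝ → H} {v : H} {t : ℝ} (hγ : HasDerivAt γ v t)
    (hv : ‖v‖ = 1) {ε : ℝ} (hε : 0 < ε) : ∃ r > 0, SteepAcross γ ε (t - r) (t + r) t := by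
  have h := Asymptotics.isLittleO_iff.1 (hasDerivAt_iff_isLittleO.1 hγ) hε
  obtain ⟨r, hr, hrs⟩ := Metric.nhds_basis_closedBall.eventually_iff.1 h
  refine ⟨r, hr, fun s hs u hu => ?_⟩
  have h1 := @hrs s (by rw [Real.closedBall_eq_Icc]; exact ⟨hs.1, by linarith [hs.2]⟩)
  have h2 := @hrs u (by rw [Real.closedBall_eq_Icc]; exact ⟨by linarith [hu.1], hu.2⟩)
  rw [Real.norm_eq_abs, abs_of_nonpos (by linarith [hs.2])] at h1
  rw [Real.norm_eq_abs, abs_of_nonneg (by linarith [hu.1])] at h2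
  have h3 : (u - s) • v = (γ s - γ t - (s - t) • v) - (γ u - γ t - (u - t) • v)
      + (γ u - γ s) := by
    rw [sub_smul, sub_smul, sub_smul]; abel
  have h4 : u - s = ‖(u - s) • v‖ := by
    rw [norm_smul, hv, Real.norm_eq_abs, abs_of_nonneg (by linarith [hs.2, hu.1]), mul_one]
  rw [h3] at h4
  have h5 := norm_add_le ((γ s - γ t - (s - t) • v) - (γ u - γ t - (u - t) • v)) (γ u - γ s)
  have h6 := norm_sub_le (γ s - γ t - (s - t) • v) (γ u - γ t - (u - t) • v)
  rw [dist_comm, dist_eq_norm]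
  linarith

end Gradient

/-! ### The cube and the main theorem -/

theorem openCube_subset_cube (d : ℕ) : openCube d ⊆ cube d := fun _ hx i =>
  Ioo_subset_Icc_self (hx i)

theorem isOpen_openCube (d : ℕ) : IsOpen (openCube d) := by
  have : openCube d = ⋂ i, {x | x i ∈ Ioo (0 : ℝ) 1} := by
    ext x
    simp [openCube]
  rw [this]
  exact isOpen_iInter_of_finite fun i =>
    isOpen_Ioo.preimage (EuclideanSpace.proj (𝕜 := ℝ) i).continuous

theorem zeroExtend_apply {d : ℕ} (f : cube d → ℝ) (x : cube d) : zeroExtend f x = f x :=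
  Subtype.val_injective.extend_apply f 0 x

theorem lipschitzOnWith_zeroExtend {d : ℕ} {f : cube d → ℝ} (hf : LipschitzWith 1 f) :
    LipschitzOnWith 1 (zeroExtend f) (cube d) := by
  rw [lipschitzOnWith_iff_restrict]
  convert hf using 1
  ext x
  exact zeroExtend_apply f x

/-- A portion has positive measure, so it cannot lie in `{0, 1}`. Dropping the endpoints turns
one-sided derivatives into two-sided ones. -/
theorem EveryPortionPositive.residual_Ioo {F : Set ℝ} (hF : EveryPortionPositive F)
    (hsub : F ⊆ Icc 0 1) : {t : F | (t : ℝ) ∈ Ioo (0 : ℝ) 1} ∈ residual F := by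
  refine residual_of_dense_open (isOpen_Ioo.preimage continuous_subtype_val)
    (dense_iff_inter_open.2 ?_)
  rintro _ hU ⟨x, hx⟩
  obtain ⟨W, hW, rfl⟩ := isOpen_induced_iff.1 hU
  by_contra hemp
  have hsub' : W ∩ F ⊆ {0, 1} := by
    rintro y ⟨hyW, hyF⟩
    by_contra hy
    simp only [mem_insert_iff, mem_singleton_iff, not_or] at hy
    have hy' := hsub hyF
    exact hemp ⟨⟨y, hyF⟩, hyW, lt_of_le_of_ne hy'.1 (Ne.symm hy.1), lt_of_le_of_ne hy'.2 hy.2⟩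
  exact (hF W hW ⟨x, hx, x.2⟩).ne' (measure_mono_null hsub' ((toFinite _).measure_zero volume))

end TypicalLip

theorem theorem2p6 (d : ℕ) (hd : 1 ≤ d) (F E : Set ℝ)
    (hFne : F.Nonempty) (hFsub : F ⊆ Set.Icc 0 1) (hFclosed : IsClosed F)
    (hFpos : TypicalLip.EveryPortionPositive F)
    (hE : TypicalLip.RelativelyResidual E F)
    (γ : ℝ → EuclideanSpace ℝ (Fin d))
    (hγ : TypicalLip.IsLipschitzCurve 1 γ)
    (hγmaps : Set.MapsTo γ (Set.Icc 0 1) (TypicalLip.openCube d))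
    (hγE : ∀ t ∈ E, ∃ v : EuclideanSpace ℝ (Fin d),
      HasDerivWithinAt γ v (Set.Icc 0 1) t ∧ ‖v‖ = 1) :
    {f : TypicalLip.Lip1 d | ∃ t ∈ E, ∃ v : EuclideanSpace ℝ (Fin d),
      HasGradientAt (TypicalLip.zeroExtend f.1) v (γ t) ∧ ‖v‖ = 1} ∈
        residual (TypicalLip.Lip1 d) := by
  -- Freezing the curve outside `[0, 1]` makes it globally `1`-Lipschitz, as the game requires.
  let γ' : ℝ → TypicalLip.cube d := fun s =>
    ⟨γ (projIcc 0 1 zero_le_one s),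
      TypicalLip.openCube_subset_cube d (hγmaps (projIcc 0 1 zero_le_one s).2)⟩
  have hγ' : LipschitzWith 1 γ' := by
    have h := hγ.1.to_restrict.comp (LipschitzWith.projIcc (zero_le_one (α := ℝ)))
    rw [mul_one] at h
    exact h
  have heq : ∀ s ∈ Icc (0 : ℝ) 1, (γ' s : EuclideanSpace ℝ (Fin d)) = γ s := fun s hs => by
    simp only [γ', projIcc_of_mem zero_le_one hs]
  have hderiv : ∀ t ∈ E, t ∈ Ioo (0 : ℝ) 1 → ∃ v, HasDerivAt γ v t ∧ ‖v‖ = 1 := fun t ht ht01 => by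
    obtain ⟨v, hv, hv1⟩ := hγE t ht
    exact ⟨v, hv.hasDerivAt (Icc_mem_nhds ht01.1 ht01.2), hv1⟩
  refine Filter.mem_of_superset (TypicalLip.residual_setOf_hasDerivAt_one hγ' hFne hFclosed hFpos
    (Filter.inter_mem hE.2 (hFpos.residual_Ioo hFsub)) ?_) ?_
  · rintro t ⟨htE, ht01⟩ ε hε
    obtain ⟨v, hv, hv1⟩ := hderiv t htE ht01
    obtain ⟨r, hr, hsteep⟩ := TypicalLip.exists_steepAcross_of_hasDerivAt hv hv1 hε
    obtain ⟨ρ, hρ, hρt⟩ := Metric.nhds_basis_closedBall.mem_iff.1 (Icc_mem_nhds ht01.1 ht01.2)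
    rw [Real.closedBall_eq_Icc] at hρt
    refine ⟨min r ρ, lt_min hr hρ, fun s hs u hu => ?_⟩
    have h1 := min_le_left r ρ
    have h2 := min_le_right r ρ
    rw [Subtype.dist_eq, heq s (hρt ⟨by linarith [hs.1], by linarith [hs.2]⟩),
      heq u (hρt ⟨by linarith [hu.1], by linarith [hu.2]⟩)]
    exact hsteep s ⟨by linarith [hs.1], hs.2⟩ u ⟨hu.1, by linarith [hu.2]⟩
  · rintro f ⟨t, ⟨htE, ht01⟩, ht⟩
    obtain ⟨v, hv, hv1⟩ := hderiv t htE ht01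
    refine ⟨t, htE, v, TypicalLip.hasGradientAt_of_hasDerivAt_one
      (TypicalLip.lipschitzOnWith_zeroExtend f.2) ?_ hv1 hv (ht.congr_of_eventuallyEq ?_), hv1⟩
    · exact Filter.mem_of_superset ((TypicalLip.isOpen_openCube d).mem_nhds
        (hγmaps (Ioo_subset_Icc_self ht01))) (TypicalLip.openCube_subset_cube d)
    · filter_upwards [Icc_mem_nhds ht01.1 ht01.2] with s hs
      rw [← heq s hs, TypicalLip.zeroExtend_apply]
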